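/- For a prime $p$ let $\omega=e^{2\pi i/p}$, and for $g:\mathbb F_p^n\to\mathbb F_p$ and $y\in\mathbb F_p^n$ let $\Delta_y g(x)=g(x+y)-g(x)$. The third Gowers norm of $g$ is $$\|g\|_{U^3}=\Bigl|\mathbb E_{x,y_1,y_2,y_3\in\mathbb F_p^n}\bigl[\omega^{\Delta_{y_3}\Delta_{y_2}\Delta_{y_1}g(x)}\bigr]\Bigr|^{1/8}.$$ Polynomials over $\mathbb F_p$ are identified when they define the same function on $\mathbb F_p^n$, and a polynomial is called cubic if the least total degree of a polynomial defining the same function is $3$. **Theorem (cubic polynomials with high $U^3$ norm).** There is an absolute constant $C>0$ such that the following holds for every prime $p$, every $n\ge 0$ and every cubic polynomial $f\in\mathbb F_p[x_1,\dots,x_n]$. Let $\delta=\|f\|_{U^3}$. Then there are an integer $c\ge 0$ with $$c+1\le C\log^2(1/\delta),$$ polynomials $q_0,\dots,q_c\in\mathbb F_p[x_1,\dots,x_n]$ of degree at most $2$ and linear forms $\ell_1,\dots,\ell_c\in\mathbb F_p[x_1,\dots,x_n]$ such that $$f=\sum_{j=1}^{c}\ell_j\cdot q_j+q_0$$ as functions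 on $\mathbb F_p^n$. -/

import Mathlib

open scoped BigOperators

/-- The iterated discrete derivative `Δ_{y_d} ⋯ Δ_{y_1} f`, where `Δ_y f (x) = f (x + y) - f x`
is Mathlib's forward difference `fwdDiff y f`. The directions are `y 0, …, y (d - 1)`. -/
def iterDeriv {V F : Type*} [AddCommGroup V] [AddCommGroup F] :
    (d : ℕ) → (Fin d → V) → (V → F) → V → F
  | 0, _, f => f
  | d + 1, y, f => iterDeriv d (Fin.tail y) (fwdDiff (y 0) f)

/-- The `d`-th Gowers norm of `f : 𝔽_p^n → 𝔽_p`,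
`|E_{x, y_1, …, y_d} ω ^ (Δ_{y_d} ⋯ Δ_{y_1} f (x))| ^ (1 / 2 ^ d)` with `ω = exp (2πi / p)`.
The character `a ↦ ω ^ a` of `𝔽_p` is Mathlib's `ZMod.stdAddChar`. -/
noncomputable def gowersNorm {p n : ℕ} [Fact p.Prime] (d : ℕ)
    (f : (Fin n → ZMod p) → ZMod p) : ℝ :=
  ‖𝔼 x : Fin n → ZMod p, 𝔼 y : Fin d → (Fin n → ZMod p),
    (ZMod.stdAddChar (iterDeriv d y f x) : ℂ)‖ ^ ((1 : ℝ) / 2 ^ d)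

/-- The function `𝔽_p^n → 𝔽_p` defined by `f` is given by some polynomial of total degree at
most `d`. Equivalently, the reduction of `f` modulo all `x_i ^ p - x_i` has degree at most `d`. -/
def HasFunDegreeLE {p n : ℕ} (f : MvPolynomial (Fin n) (ZMod p)) (d : ℕ) : Prop :=
  ∃ g : MvPolynomial (Fin n) (ZMod p), g.totalDegree ≤ d ∧
    ∀ x : Fin n → ZMod p, MvPolynomial.eval x g = MvPolynomial.eval x f

/-- `f` is cubic: as a function on `𝔽_p^n` it has degree exactly three. -/
def IsCubicPoly {p n : ℕ} (f : MvPolynomial (Fin n) (ZMod p)) : Prop :=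
  HasFunDegreeLE f 3 ∧ ¬ HasFunDegreeLE f 2

/-! ### Linear spaces of symmetric forms of bounded rank -/

section SymmetricForms

open Module LinearMap

variable {K V : Type*} [Field K] [AddCommGroup V] [Module K V] [FiniteDimensional K V]

/-! The third difference of a cubic `f` is independent of the base point, so it is a symmetric
trilinear form `T`. Summing out one variable shows that `β = ‖f‖_{U³}^8` is the average over `a` of
`|ker T_a| / |V| = p ^ (-rank T_a)`. Put `L = log (2/β)`. At least a proportion `β/2` of all `a`
form a cone `A` on which `rank T_a = O(L)`. A Bogolyubov-type theorem for cones
(`exists_submodule_forall_mem_eq_add_sum`) gives a subspace `H` of codimension `O(L)`, each element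
of which is a sum of only `O(L)` elements of `A`. Since rank is subadditive, `rank T_h = O(L²)` on
all of `H`.

A linear space of symmetric forms of rank at most `r` vanishes on a common subspace of codimension
`2r` (`exists_isotropic_of_finrank_range_le`). Hence `T` vanishes on some `U` of codimension
`O(L²)`. Projecting along one direction at a time changes `f` by (linear) · (quadratic) and enlarges
`U` by one dimension. Once `U` is everything, the remainder is quadratic
(`exists_eval_eq_sum_mul_add_of_fwdDiff_eq_zero`). No step divides by `3!`, so small `p` needs no
exclusion. As `f` is not quadratic, `β ≤ 3/4`, and `log² (1/δ)` absorbs the lower-order terms. -/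

lemma finrank_range_add_le_of_finiteDimensional {M M' : Type*} [AddCommGroup M] [Module K M]
    [AddCommGroup M'] [Module K M'] [FiniteDimensional K M'] (f g : M →ₗ[K] M') :
    finrank K (range (f + g)) ≤ finrank K (range f) + finrank K (range g) :=
  (Submodule.finrank_mono (range_add_le f g)).trans
    (Submodule.finrank_add_le_finrank_add_finrank _ _)

/-- Restricting a symmetric form to the kernel of another one. -/
lemma two_mul_finrank_range_restrict_ker_add_le {B₁ B₂ : LinearMap.BilinForm K V} (h₁ : B₁.IsSymm)
    (h₂ : B₂.IsSymm) :
    2 * finrank K (range (B₂.restrict (ker B₁))) + finrank K (range B₁) ≤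
      finrank K (range B₂) + finrank K (range (B₁ + B₂)) := by
  set W := ker B₁ with hW
  set R := (ker (B₂.restrict W)).map W.subtype with hR
  have hRdim : finrank K R = finrank K (ker (B₂.restrict W)) :=
    Submodule.finrank_map_subtype_eq _ _
  have hmem : ∀ x ∈ ker B₂ ⊓ W, x ∈ R := by
    rintro x ⟨hx, hxW⟩
    refine ⟨⟨x, hxW⟩, ?_, rfl⟩
    ext w
    have : B₂ x = 0 := hx
    simp [this]
  have hNN : ker B₂ ⊓ ker (B₁ + B₂) ≤ R := by
    rintro x ⟨hx, hx'⟩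
    refine hmem x ⟨hx, ?_⟩
    have e₂ : B₂ x = 0 := hx
    have e : B₁ x + B₂ x = 0 := hx'
    rw [e₂, add_zero] at e
    exact e
  have hNW : W ⊓ B₂.orthogonal ⊤ ≤ R := by
    rintro x ⟨hxW, hx⟩
    refine hmem x ⟨?_, hxW⟩
    ext y
    have : B₂ y x = 0 := hx y trivial
    rw [h₂.eq x y, this]; rfl
  have hsup : ker B₂ ⊔ ker (B₁ + B₂) ≤ B₂.orthogonal W := by
    refine sup_le ?_ ?_
    · intro x hx w _
      have e₂ : B₂ x = 0 := hx
      change B₂ w x = 0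
      rw [h₂.eq w x, e₂]; rfl
    · intro x hx w hw
      have e : B₁ x + B₂ x = 0 := hx
      have e' := LinearMap.congr_fun e w
      have hw' : B₁ w = 0 := hw
      rw [LinearMap.add_apply, h₁.eq x w, hw'] at e'
      change B₂ w x = 0
      rw [h₂.eq w x]
      simpa using e'
  -- Both kernels are `B₂`-orthogonal to `W` and meet inside the radical `R` of `B₂` on `W`. Thus
  -- their dimensions add up to at most `dim W^⊥ + dim R`, while `dim W + dim W^⊥ ≤ dim V + dim R`.
  have d₁ := Submodule.finrank_sup_add_finrank_inf_eq (ker B₂) (ker (B₁ + B₂))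
  have d₂ := Submodule.finrank_mono hsup
  have d₃ := LinearMap.BilinForm.finrank_add_finrank_orthogonal h₂.isRefl W
  have d₄ := Submodule.finrank_mono hNN
  have d₅ := Submodule.finrank_mono hNW
  have e₁ := finrank_range_add_finrank_ker B₁
  rw [← hW] at e₁
  have e₂ := finrank_range_add_finrank_ker B₂
  have e₃ := finrank_range_add_finrank_ker (B₁ + B₂)
  have e₄ := finrank_range_add_finrank_ker (B₂.restrict W)
  omega

/-- A linear space of symmetric forms of rank at most `r` vanishes on a subspace of codimension
at most `2 * r`. -/
theorem exists_isotropic_of_finrank_range_le {K : Type*} [Field K] (r : ℕ) :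
    ∀ {V : Type*} [AddCommGroup V] [Module K V] [FiniteDimensional K V]
      (S : Submodule K (LinearMap.BilinForm K V)), (∀ B ∈ S, B.IsSymm) →
      (∀ B ∈ S, finrank K (range B) ≤ r) →
      ∃ W : Submodule K V, finrank K V ≤ finrank K W + 2 * r ∧
        ∀ B ∈ S, ∀ u ∈ W, ∀ v ∈ W, B u v = 0 := by
  induction r using Nat.strong_induction_on with
  | _ r ih =>
  intro V _ _ _ S hsymm hrank
  obtain ⟨B₁, hB₁, hmax⟩ : ∃ B₁ ∈ S, ∀ B ∈ S, finrank K (range B) ≤ finrank K (range B₁) := by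
    have hfin : ((fun B : LinearMap.BilinForm K V => finrank K (range B)) '' S).Finite :=
      (Set.finite_le_nat r).subset (by rintro _ ⟨B, hB, rfl⟩; exact hrank B hB)
    obtain ⟨_, ⟨B₁, hB₁, rfl⟩, h⟩ :=
      hfin.exists_maximal (Set.Nonempty.image _ ⟨0, S.zero_mem⟩)
    refine ⟨B₁, hB₁, fun B hB => ?_⟩
    rcases le_total (finrank K (range B)) (finrank K (range B₁)) with h' | h'
    · exact h'
    · exact h ⟨B, hB, rfl⟩ h'
  rcases Nat.eq_zero_or_pos r with rfl | hr
  · refine ⟨⊤, by simp, fun B hB u _ v _ => ?_⟩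
    have h0 := Nat.le_zero.1 (hrank B hB)
    rw [Submodule.finrank_eq_zero, LinearMap.range_eq_bot] at h0
    simp [h0]
  · let φ : LinearMap.BilinForm K V →ₗ[K] LinearMap.BilinForm K (ker B₁) :=
      { toFun := fun B => B.restrict (ker B₁)
        map_add' := fun _ _ => rfl
        map_smul' := fun _ _ => rfl }
    -- By maximality `B` and `B₁ + B` have rank at most `rank B₁`, so the preceding inequality
    -- halves the rank on `ker B₁`. The codimensions add up to at most `r + 2 (r / 2) ≤ 2 r`.
    obtain ⟨W, hWdim, hW⟩ := ih (r / 2) (Nat.div_lt_self hr one_lt_two) (S.map φ)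
      (by
        rintro _ ⟨B, hB, rfl⟩
        exact ⟨fun x y => (hsymm B hB).eq x y⟩)
      (by
        rintro _ ⟨B, hB, rfl⟩
        have h := two_mul_finrank_range_restrict_ker_add_le (hsymm B₁ hB₁) (hsymm B hB)
        have h₁ := hmax _ hB
        have h₂ := hmax _ (S.add_mem hB₁ hB)
        have h₃ := hrank _ hB₁
        change finrank K (range (B.restrict (ker B₁))) ≤ r / 2
        omega)
    refine ⟨W.map (ker B₁).subtype, ?_, ?_⟩
    · have e₁ := finrank_range_add_finrank_ker B₁
      have h₃ := hrank _ hB₁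
      rw [Submodule.finrank_map_subtype_eq]
      omega
    · rintro B hB _ ⟨u, hu, rfl⟩ _ ⟨v, hv, rfl⟩
      exact hW _ ⟨B, hB, rfl⟩ u hu v hv

end SymmetricForms

/-! ### Fourier-analytic covering -/

section Covering

lemma AddChar.map_sum_eq_prod_apply {A M ι : Type*} [AddCommMonoid A] [CommMonoid M]
    (χ : AddChar A M) (s : Finset ι) (g : ι → A) : χ (∑ i ∈ s, g i) = ∏ i ∈ s, χ (g i) := by
  classical
  induction s using Finset.induction_on with
  | empty => simp
  | insert i s hi ih => rw [Finset.sum_insert hi, Finset.prod_insert hi, χ.map_add_eq_mul, ih]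

/-- If the nontrivial Fourier coefficients of the family `g` are small, then the sums of two
elements of `A` and sufficiently many members of `g` cover the group. -/
theorem exists_add_sum_eq_of_norm_sum_addChar_le {G ι : Type*} [AddCommGroup G] [Finite G]
    [Fintype ι] (A : Finset G) (g : ι → G) {θ : ℝ} (hθ : 0 ≤ θ) {k : ℕ}
    (hg : ∀ χ : AddChar G ℂ, χ ≠ 0 → ‖∑ i, χ (g i)‖ ≤ θ * Fintype.card ι)
    (hι : 0 < Fintype.card ι) (hA : θ ^ k * Nat.card G < A.card) (h : G) :
    ∃ a ∈ A, ∃ b ∈ A, ∃ t : Fin k → ι, h = a + b + ∑ j, g (t j) := by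
  classical
  have := Fintype.ofFinite G
  rw [Nat.card_eq_fintype_card] at hA
  by_contra! hne
  set S : AddChar G ℂ → ℂ := fun χ => ∑ a ∈ A, χ a with hS
  set P : AddChar G ℂ → ℂ := fun χ => ∑ i, χ (g i) with hP
  -- Up to the factor `|G|` this counts the representations of `h`. The trivial character
  -- contributes `|A|² |ι|^k`; the others are bounded by `θ^k` from the family and Parseval for the
  -- two copies of `A`.
  have hzero : ∑ χ : AddChar G ℂ, χ (-h) * (S χ * S χ * P χ ^ k) = 0 := by
    have : ∀ χ : AddChar G ℂ, χ (-h) * (S χ * S χ * P χ ^ k) =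
        ∑ a ∈ A, ∑ b ∈ A, ∑ t : Fin k → ι, χ (a + b + ∑ j, g (t j) - h) := by
      intro χ
      have hprod : ∀ t : Fin k → ι, χ (∑ j, g (t j)) = ∏ j, χ (g (t j)) := fun t =>
        χ.map_sum_eq_prod_apply _ _
      simp only [hS, hP, sub_eq_add_neg, AddChar.map_add_eq_mul, hprod, Fintype.sum_pow,
        ← Finset.mul_sum, ← Finset.sum_mul]
      ring
    simp_rw [this]
    rw [Finset.sum_comm]
    refine Finset.sum_eq_zero fun a ha => ?_
    rw [Finset.sum_comm]
    refine Finset.sum_eq_zero fun b hb => ?_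
    rw [Finset.sum_comm]
    refine Finset.sum_eq_zero fun t _ => ?_
    rw [AddChar.sum_apply_eq_ite, if_neg]
    rw [sub_eq_zero]
    exact (hne a ha b hb t).symm
  have hparseval : ∑ χ : AddChar G ℂ, ‖S χ‖ ^ 2 = Fintype.card G * A.card := by
    have : ((∑ χ : AddChar G ℂ, ‖S χ‖ ^ 2 : ℝ) : ℂ) = Fintype.card G * A.card := by
      push_cast
      have : ∀ χ : AddChar G ℂ, ((‖S χ‖ : ℂ)) ^ 2 = ∑ a ∈ A, ∑ b ∈ A, χ (a - b) := by
        intro χ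
        rw [← Complex.mul_conj', hS, map_sum, Finset.sum_mul_sum]
        simp [sub_eq_add_neg, AddChar.map_add_eq_mul, AddChar.map_neg_eq_conj]
      simp_rw [this]
      rw [Finset.sum_comm]
      have : ∀ a ∈ A, ∑ χ : AddChar G ℂ, ∑ b ∈ A, χ (a - b) = Fintype.card G := by
        intro a ha
        rw [Finset.sum_comm]
        simp_rw [AddChar.sum_apply_eq_ite, sub_eq_zero]
        simp [ha]
      rw [Finset.sum_congr rfl this]
      simp [mul_comm]
    exact_mod_cast this
  have hsplit : ‖(A.card : ℂ) * A.card * (Fintype.card ι : ℂ) ^ k‖ ≤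
      ∑ χ ∈ Finset.univ.erase (0 : AddChar G ℂ), ‖χ (-h) * (S χ * S χ * P χ ^ k)‖ := by
    rw [← Finset.add_sum_erase _ _ (Finset.mem_univ (0 : AddChar G ℂ))] at hzero
    have h0 : (0 : AddChar G ℂ) (-h) * (S 0 * S 0 * P 0 ^ k) =
        (A.card : ℂ) * A.card * (Fintype.card ι : ℂ) ^ k := by
      simp [hS, hP]
    rw [h0] at hzero
    rw [eq_neg_of_add_eq_zero_left hzero, norm_neg]
    exact norm_sum_le _ _
  have hbound : ∑ χ ∈ Finset.univ.erase (0 : AddChar G ℂ), ‖χ (-h) * (S χ * S χ * P χ ^ k)‖ ≤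
      (θ * Fintype.card ι) ^ k * (Fintype.card G * A.card) := by
    rw [← hparseval, Finset.mul_sum]
    refine (Finset.sum_le_sum fun χ hχ => ?_).trans
      (Finset.sum_le_sum_of_subset_of_nonneg (Finset.erase_subset _ _) fun χ _ _ => ?_)
    · rw [norm_mul, norm_mul, norm_mul, norm_pow, AddChar.norm_apply, one_mul, mul_comm, ← sq]
      gcongr
      exact hg χ (Finset.ne_of_mem_erase hχ)
    · positivity
  have hle := hsplit.trans hbound
  rw [mul_pow, norm_mul, norm_mul, norm_pow, RCLike.norm_natCast, RCLike.norm_natCast] at hle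
  have hApos : (0 : ℝ) < A.card := lt_of_le_of_lt (by positivity) hA
  have hιpos : (0 : ℝ) < (Fintype.card ι : ℝ) ^ k := by positivity
  have hlt := mul_lt_mul_of_pos_right hA (mul_pos hApos hιpos)
  linarith

/-- The Fourier coefficients of the indicator function of a cone are determined by the density of
the cone on hyperplanes. -/
lemma sub_one_mul_sum_addChar_of_smul_mem {p : ℕ} [Fact p.Prime] {G : Type*} [AddCommGroup G]
    [Module (ZMod p) G] (A : Finset G) (hA : ∀ c : ZMod p, c ≠ 0 → ∀ a ∈ A, c • a ∈ A)
    (χ : AddChar G ℂ) :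
    ((p : ℂ) - 1) * ∑ a ∈ A, χ a = p * ({a ∈ A | χ a = 1} : Finset G).card - A.card := by
  classical
  have hinner : ∀ a : G, ∑ c : ZMod p, χ (c • a) = if χ a = 1 then (p : ℂ) else 0 := by
    intro a
    let ψ : AddChar (ZMod p) ℂ :=
      { toFun := fun c => χ (c • a)
        map_zero_eq_one' := by simp
        map_add_eq_mul' := fun c d => by rw [add_smul, χ.map_add_eq_mul] }
    have hψ : ψ = 0 ↔ χ a = 1 := by
      rw [AddChar.eq_zero_iff]
      constructor
      · intro h
        have h1 : χ ((1 : ZMod p) • a) = 1 := h 1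
        rwa [one_smul] at h1
      · intro h c
        change χ (c • a) = 1
        rw [← ZMod.natCast_zmod_val c, Nat.cast_smul_eq_nsmul, χ.map_nsmul_eq_pow, h, one_pow]
    have := AddChar.sum_eq_ite ψ
    rw [ZMod.card] at this
    simp only [hψ] at this
    exact this
  have hshift : ∀ c : ZMod p, c ≠ 0 → ∑ a ∈ A, χ (c • a) = ∑ a ∈ A, χ a := by
    intro c hc
    refine Finset.sum_nbij' (fun a => c • a) (fun a => c⁻¹ • a) (fun a ha => hA c hc a ha)
      (fun a ha => hA _ (inv_ne_zero hc) a ha) ?_ ?_ fun a _ => rfl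
    · intro a _
      exact inv_smul_smul₀ hc a
    · intro a _
      exact smul_inv_smul₀ hc a
  -- Orthogonality over the dilates `c` detects `χ a = 1`. By the cone property all `c ≠ 0` give the
  -- same sum, and `c = 0` gives `|A|`.
  have h₁ : ∑ c : ZMod p, ∑ a ∈ A, χ (c • a) =
      p * ({a ∈ A | χ a = 1} : Finset G).card := by
    rw [Finset.sum_comm]
    simp_rw [hinner]
    rw [← Finset.sum_filter, Finset.sum_const, nsmul_eq_mul, mul_comm]
  rw [← Finset.add_sum_erase _ _ (Finset.mem_univ (0 : ZMod p)),
    Finset.sum_congr rfl fun c hc => hshift c (Finset.ne_of_mem_erase hc)] at h₁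
  rw [← h₁, Finset.sum_const, Finset.card_erase_of_mem (Finset.mem_univ _), Finset.card_univ,
    ZMod.card, nsmul_eq_mul, Nat.cast_sub (Fact.out : p.Prime).one_le]
  simp

/-- If a cone `A` has relative density at most `3 / 4` on every hyperplane, its nontrivial
Fourier coefficients, made lazy, are at most `7 / 8`. -/
lemma norm_card_add_sum_addChar_le {p : ℕ} [Fact p.Prime] {G : Type*} [AddCommGroup G]
    [Module (ZMod p) G] (A : Finset G) (hA : ∀ c : ZMod p, c ≠ 0 → ∀ a ∈ A, c • a ∈ A)
    (χ : AddChar G ℂ) (hχ : (({a ∈ A | χ a = 1} : Finset G).card : ℝ) ≤ 3 / 4 * A.card) :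
    ‖(A.card : ℂ) + ∑ a ∈ A, χ a‖ ≤ 7 / 8 * (2 * A.card) := by
  have h := sub_one_mul_sum_addChar_of_smul_mem A hA χ
  set m := ({a ∈ A | χ a = 1} : Finset G).card with hm
  have hp : (2 : ℝ) ≤ p := by exact_mod_cast (Fact.out : p.Prime).two_le
  have hp1 : (0 : ℝ) < p - 1 := by linarith
  have hS : ∑ a ∈ A, χ a = (((p * m - A.card) / (p - 1) : ℝ) : ℂ) := by
    have : (p : ℂ) - 1 ≠ 0 := by
      have : ((p - 1 : ℝ) : ℂ) ≠ 0 := by exact_mod_cast hp1.ne'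
      simpa using this
    push_cast
    rw [eq_div_iff this, mul_comm, h]
  rw [hS, ← Complex.ofReal_natCast, ← Complex.ofReal_add, Complex.norm_real, Real.norm_eq_abs,
    abs_le]
  have hm0 : (0 : ℝ) ≤ m := Nat.cast_nonneg _
  have hA0 : (0 : ℝ) ≤ A.card := Nat.cast_nonneg _
  -- The coefficient is real, between `-|A|` and `3/4 |A|`. Adding `|A|` removes the danger at the
  -- negative end, which is real for `p = 2`.
  have hlow : -(A.card : ℝ) ≤ (p * m - A.card) / (p - 1) := by
    rw [le_div_iff₀ hp1]
    nlinarith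
  have hupp : (p * m - A.card) / (p - 1) ≤ (m : ℝ) := by
    rw [div_le_iff₀ hp1]
    nlinarith
  constructor <;> linarith

end Covering

/-! ### A Bogolyubov-type theorem for cones -/

section Bogolyubov

open Module

variable {p : ℕ} [Fact p.Prime] {V : Type*} [AddCommGroup V] [Module (ZMod p) V] [Finite V]

/-- A cone contains, after few summations, a subspace of small codimension. -/
theorem exists_submodule_forall_mem_eq_add_sum (A : Finset V) (hA0 : 0 ∈ A)
    (hA : ∀ c : ZMod p, c ≠ 0 → ∀ a ∈ A, c • a ∈ A) :
    ∃ H : Submodule (ZMod p) V,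
      (3 / 2 : ℝ) ^ finrank (ZMod p) (V ⧸ H) * A.card ≤ Nat.card V ∧
      ∀ k : ℕ, (7 / 8 : ℝ) ^ k * Nat.card V < A.card → ∀ h ∈ H,
        ∃ a ∈ A, ∃ b ∈ A, ∃ t : Fin k → V, (∀ j, t j ∈ A) ∧ h = a + b + ∑ j, t j := by
  classical
  have := Fintype.ofFinite V
  -- Density increment in one stroke: at a maximiser of `Φ`, passing to a subspace of codimension
  -- one keeps at most `3/4` of `A ∩ H`. Comparison with `⊤` bounds the codimension, with `3/2 = 2 /
  -- (4/3)`.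
  let Φ : Submodule (ZMod p) V → ℝ := fun H =>
    ({a ∈ A | a ∈ H} : Finset V).card * (4 / 3 : ℝ) ^ finrank (ZMod p) (V ⧸ H)
  obtain ⟨H, hH⟩ := Finite.exists_max Φ
  have hcard : (Nat.card V : ℝ) =
      (p : ℝ) ^ finrank (ZMod p) (V ⧸ H) * (p : ℝ) ^ finrank (ZMod p) H := by
    rw [Nat.card_eq_fintype_card, Module.card_eq_pow_finrank (K := ZMod p), ZMod.card,
      ← Submodule.finrank_quotient_add_finrank H, pow_add]
    push_cast
    rfl
  have hcardH : (Nat.card H : ℝ) = (p : ℝ) ^ finrank (ZMod p) H := by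
    rw [Nat.card_eq_fintype_card, Module.card_eq_pow_finrank (K := ZMod p), ZMod.card]
    push_cast
    rfl
  have htop : (A.card : ℝ) ≤ Φ H := by
    refine le_trans (le_of_eq ?_) (hH ⊤)
    have : finrank (ZMod p) (V ⧸ (⊤ : Submodule (ZMod p) V)) = 0 :=
      finrank_zero_of_subsingleton
    simp [Φ, this]
  have hle : (({a ∈ A | a ∈ H} : Finset V).card : ℝ) ≤ Nat.card H := by
    rw [← Finset.card_subtype, Nat.card_eq_fintype_card]
    exact_mod_cast Finset.card_le_univ _
  have hp : (2 : ℝ) ≤ p := by exact_mod_cast (Fact.out : p.Prime).two_le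
  refine ⟨H, ?_, ?_⟩
  · calc (3 / 2 : ℝ) ^ finrank (ZMod p) (V ⧸ H) * A.card
        ≤ (3 / 2 : ℝ) ^ finrank (ZMod p) (V ⧸ H) *
          (Nat.card H * (4 / 3 : ℝ) ^ finrank (ZMod p) (V ⧸ H)) := by
          gcongr
          exact htop.trans (mul_le_mul_of_nonneg_right hle (by positivity))
      _ = 2 ^ finrank (ZMod p) (V ⧸ H) * Nat.card H := by
          rw [mul_left_comm, ← mul_pow, mul_comm]; norm_num
      _ ≤ (p : ℝ) ^ finrank (ZMod p) (V ⧸ H) * Nat.card H := by gcongr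
      _ = Nat.card V := by rw [hcard, hcardH]
  · intro k hk h hh
    let B : Finset H := A.subtype (· ∈ H)
    have hBcard : B.card = ({a ∈ A | a ∈ H} : Finset V).card := Finset.card_subtype _ _
    have hB : ∀ c : ZMod p, c ≠ 0 → ∀ a ∈ B, c • a ∈ B := by
      intro c hc a ha
      simp only [B, Finset.mem_subtype] at ha ⊢
      exact hA c hc _ ha
    have hBpos : 0 < B.card := Finset.card_pos.2 ⟨0, by simpa [B] using hA0⟩
    have hdens : ∀ χ : AddChar H ℂ, χ ≠ 0 →
        (({a ∈ B | χ a = 1} : Finset H).card : ℝ) ≤ 3 / 4 * B.card := by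
      intro χ hχ
      let Kχ : Submodule (ZMod p) H := AddSubgroup.toZModSubmodule p
        { carrier := {x | χ x = 1}
          zero_mem' := by simp
          add_mem' := by
            intro a b ha hb
            simp only [Set.mem_ofPred_eq] at ha hb ⊢
            rw [χ.map_add_eq_mul, ha, hb, one_mul]
          neg_mem' := by
            intro a ha
            simp only [Set.mem_ofPred_eq] at ha ⊢
            rw [χ.map_neg_eq_inv, ha, inv_one] }
      have hKmem : ∀ x, x ∈ Kχ ↔ χ x = 1 := fun x => Iff.rfl
      let H' : Submodule (ZMod p) V := Kχ.map H.subtype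
      have hlt : finrank (ZMod p) H' < finrank (ZMod p) H := by
        rw [Submodule.finrank_map_subtype_eq]
        refine Submodule.finrank_lt fun htop => hχ ?_
        rw [AddChar.eq_zero_iff]
        intro x
        rw [← hKmem, htop]
        trivial
      have hq := Submodule.finrank_quotient_add_finrank H
      have hq' := Submodule.finrank_quotient_add_finrank H'
      have hcodim : finrank (ZMod p) (V ⧸ H) + 1 ≤ finrank (ZMod p) (V ⧸ H') := by omega
      have hcard' : ({a ∈ B | χ a = 1} : Finset H).card =
          ({a ∈ A | a ∈ H'} : Finset V).card := by
        rw [← Finset.card_map (Function.Embedding.subtype _)]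
        congr 1
        ext x
        simp only [B, H', Finset.mem_map, Finset.mem_filter, Finset.mem_subtype,
          Submodule.mem_map, hKmem]
        constructor
        · rintro ⟨a, ⟨ha, hχa⟩, rfl⟩
          exact ⟨ha, a, hχa, rfl⟩
        · rintro ⟨hx, a, hχa, rfl⟩
          exact ⟨a, ⟨hx, hχa⟩, rfl⟩
      have hmax := hH H'
      simp only [Φ] at hmax
      rw [hcard', hBcard]
      have hpow : (4 / 3 : ℝ) ^ (finrank (ZMod p) (V ⧸ H) + 1) ≤
          (4 / 3 : ℝ) ^ finrank (ZMod p) (V ⧸ H') := pow_le_pow_right₀ (by norm_num) hcodim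
      have hmul := (mul_le_mul_of_nonneg_left hpow
        (Nat.cast_nonneg ({a ∈ A | a ∈ H'} : Finset V).card)).trans hmax
      rw [pow_succ] at hmul
      have hpos : (0 : ℝ) < (4 / 3 : ℝ) ^ finrank (ZMod p) (V ⧸ H) := by positivity
      refine le_of_mul_le_mul_right ?_ hpos
      linarith
    -- The second copy of `B` supplies the zero steps of the lazy walk; `0 ∈ A` keeps them in `A`.
    let g : B ⊕ B → H := Sum.elim (fun a => a) (fun _ => 0)
    have hgA : ∀ i, (g i : V) ∈ A := by
      rintro (i | i)
      · exact Finset.mem_subtype.1 i.2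
      · exact hA0
    have hgcard : (Fintype.card (B ⊕ B) : ℝ) = 2 * B.card := by
      rw [Fintype.card_sum, Fintype.card_coe]
      push_cast
      ring
    have hgsum : ∀ χ : AddChar H ℂ, ∑ i, χ (g i) = B.card + ∑ a ∈ B, χ a := by
      intro χ
      rw [Fintype.sum_sum_type]
      simp only [g, Sum.elim_inl, Sum.elim_inr, AddChar.map_zero_eq_one]
      rw [add_comm, Finset.sum_coe_sort B (fun a => χ a)]
      simp
    obtain ⟨a, ha, b, hb, t, ht⟩ := exists_add_sum_eq_of_norm_sum_addChar_le B g
      (θ := 7 / 8) (by norm_num) (k := k)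
      (fun χ hχ => by
        rw [hgsum, hgcard]
        exact norm_card_add_sum_addChar_le B hB χ (hdens χ hχ))
      (by rw [Fintype.card_sum, Fintype.card_coe]; omega)
      (by
        have h43 : (4 / 3 : ℝ) ^ finrank (ZMod p) (V ⧸ H) ≤
            (p : ℝ) ^ finrank (ZMod p) (V ⧸ H) := by gcongr; linarith
        have hpos : (0 : ℝ) < (p : ℝ) ^ finrank (ZMod p) (V ⧸ H) := by positivity
        have h1 : (A.card : ℝ) ≤ B.card * (p : ℝ) ^ finrank (ZMod p) (V ⧸ H) := by
          rw [hBcard]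
          exact htop.trans (mul_le_mul_of_nonneg_left h43 (Nat.cast_nonneg _))
        rw [hcard, ← hcardH] at hk
        refine lt_of_mul_lt_mul_right ?_ hpos.le
        calc _ = (7 / 8 : ℝ) ^ k * ((p : ℝ) ^ finrank (ZMod p) (V ⧸ H) * Nat.card H) := by ring
          _ < A.card := hk
          _ ≤ _ := h1)
      ⟨h, hh⟩
    refine ⟨a, Finset.mem_subtype.1 ha, b, Finset.mem_subtype.1 hb, fun j => g (t j), ?_, ?_⟩
    · exact fun j => hgA (t j)
    · have := congrArg (H.subtype) ht
      simpa using this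

end Bogolyubov

/-! ### Iterated differences as multilinear forms -/

section Differences

variable {p : ℕ} [Fact p.Prime] {V : Type*} [AddCommGroup V] [Module (ZMod p) V]

lemma fwdDiff_comm {V F : Type*} [AddCommGroup V] [AddCommGroup F] (a b : V) (f : V → F) :
    fwdDiff a (fwdDiff b f) = fwdDiff b (fwdDiff a f) := by
  ext x
  simp only [fwdDiff, add_right_comm x a b]
  abel

lemma fwdDiff_add_apply_of_const {V F : Type*} [AddCommGroup V] [AddCommGroup F] {f : V → F}
    (hf : ∀ a x, fwdDiff a f x = fwdDiff a f 0) (a b x : V) :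
    fwdDiff (a + b) f x = fwdDiff a f x + fwdDiff b f x := by
  have h : fwdDiff (a + b) f x = fwdDiff a f (x + b) + fwdDiff b f x := by
    simp only [fwdDiff, add_right_comm x b a, add_assoc]
    abel
  rw [h, hf a (x + b), hf a x]

lemma apply_eq_apply_zero_of_fwdDiff_eq_zero {V F : Type*} [AddCommGroup V] [AddCommGroup F]
    {f : V → F} (hf : ∀ a x, fwdDiff a f x = 0) (x : V) : f x = f 0 := by
  have := hf x 0
  rwa [fwdDiff, zero_add, sub_eq_zero] at this

lemma fwdDiff_comp_linearMap {F : Type*} [AddCommGroup F] (σ : V →ₗ[ZMod p] V) (f : V → F)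
    (a : V) : fwdDiff a (f ∘ σ) = fwdDiff (σ a) f ∘ σ := by
  ext x
  simp [fwdDiff]

/-- Constant differences are additive in the direction, and additive maps over `ZMod p` are linear.
The bilinear and trilinear versions follow because differences commute. -/
lemma exists_linearMap_of_fwdDiff_fwdDiff_eq_zero {f : V → ZMod p}
    (hf : ∀ a b x, fwdDiff b (fwdDiff a f) x = 0) :
    ∃ L : V →ₗ[ZMod p] ZMod p, ∀ a x, L a = fwdDiff a f x := by
  have h0 : ∀ a x, fwdDiff a f x = fwdDiff a f 0 := fun a x =>
    apply_eq_apply_zero_of_fwdDiff_eq_zero (hf a) x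
  refine ⟨AddMonoidHom.toZModLinearMap p (AddMonoidHom.mk' (fun a => fwdDiff a f 0)
    fun a b => fwdDiff_add_apply_of_const h0 a b 0), fun a x => ?_⟩
  rw [h0 a x]
  rfl

lemma exists_bilinForm_of_fwdDiff_eq_zero {f : V → ZMod p}
    (hf : ∀ a b c x, fwdDiff c (fwdDiff b (fwdDiff a f)) x = 0) :
    ∃ B : LinearMap.BilinForm (ZMod p) V, ∀ a b x, B a b = fwdDiff b (fwdDiff a f) x := by
  choose L hL using fun a => exists_linearMap_of_fwdDiff_fwdDiff_eq_zero (hf a)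
  refine ⟨AddMonoidHom.toZModLinearMap p (AddMonoidHom.mk' L fun a b => ?_), fun a b x => hL a b x⟩
  ext c
  rw [LinearMap.add_apply, hL _ c 0, hL _ c 0, hL _ c 0, fwdDiff_comm c (a + b),
    fwdDiff_comm c a, fwdDiff_comm c b]
  refine fwdDiff_add_apply_of_const (fun d x => ?_) a b 0
  rw [fwdDiff_comm d c, ← hL d c x, ← hL d c 0]

lemma exists_trilinear_of_fwdDiff_eq_zero {f : V → ZMod p}
    (hf : ∀ a b c d x, fwdDiff d (fwdDiff c (fwdDiff b (fwdDiff a f))) x = 0) :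
    ∃ T : V →ₗ[ZMod p] LinearMap.BilinForm (ZMod p) V,
      ∀ a b c x, T a b c = fwdDiff c (fwdDiff b (fwdDiff a f)) x := by
  choose B hB using fun a => exists_bilinForm_of_fwdDiff_eq_zero (hf a)
  refine ⟨AddMonoidHom.toZModLinearMap p (AddMonoidHom.mk' B fun a b => ?_),
    fun a b c x => hB a b c x⟩
  have hcomm : ∀ a c d : V, fwdDiff d (fwdDiff c (fwdDiff a f)) =
      fwdDiff a (fwdDiff d (fwdDiff c f)) := fun a c d => by
    rw [fwdDiff_comm c a, fwdDiff_comm d a]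
  refine LinearMap.ext fun c => LinearMap.ext fun d => ?_
  rw [LinearMap.add_apply, LinearMap.add_apply, hB _ c d 0, hB _ c d 0, hB _ c d 0,
    hcomm (a + b) c d, hcomm a c d, hcomm b c d]
  refine fwdDiff_add_apply_of_const (f := fwdDiff d (fwdDiff c f)) (fun e x => ?_) a b 0
  rw [← hcomm e c d, ← hB e c d x, ← hB e c d 0]

end Differences

/-! ### Shears of polynomials and removal of linear factors -/

section Polynomials

open MvPolynomial

variable {K σ : Type*} [Field K]

/-- Peel off one factor: `(x_i + l e_i)(P + l q) = x_i P + l (e_i (P + l q) + x_i q)`. Allowing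
affine `l` covers both translations (`l = 1`) and the projections used below. -/
lemma exists_eval_multiset_prod_add_smul (l : MvPolynomial σ K) (hl : l.totalDegree ≤ 1)
    (e : σ → K) (s : Multiset σ) : ∀ d : ℕ, s.card ≤ d + 1 →
    ∃ q : MvPolynomial σ K, q.totalDegree ≤ d ∧ ∀ x : σ → K,
      eval (x + eval x l • e) (s.map X).prod = eval x (s.map X).prod + eval x l * eval x q := by
  have hprod : ∀ t : Multiset σ, ((t.map (X (R := K))).prod).totalDegree ≤ t.card := by
    intro t
    refine (totalDegree_multiset_prod _).trans ?_
    rw [Multiset.map_map]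
    simp
  induction s using Multiset.induction_on with
  | empty => exact fun d _ => ⟨0, by simp, by simp⟩
  | cons i t ih =>
    rintro (_ | d) hd
    · have ht : t = 0 := by simpa using hd
      subst ht
      refine ⟨C (e i), by simp, fun x => ?_⟩
      simp
    · rw [Multiset.card_cons] at hd
      obtain ⟨q, hq, h⟩ := ih d (by omega)
      refine ⟨C (e i) * ((t.map X).prod + l * q) + X i * q, ?_, fun x => ?_⟩
      · have h₁ := hprod t
        have h₂ := totalDegree_mul l q
        have h₃ := totalDegree_add (t.map (X (R := K))).prod (l * q)
        have h₄ := totalDegree_mul (C (e i)) ((t.map X).prod + l * q)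
        have h₅ := totalDegree_mul (X i) q
        rw [totalDegree_C] at h₄
        rw [totalDegree_X] at h₅
        refine (totalDegree_add _ _).trans ?_
        omega
      · simp only [Multiset.map_cons, Multiset.prod_cons, map_mul, map_add, eval_X, eval_C, h x,
          Pi.add_apply, Pi.smul_apply, smul_eq_mul]
        ring

/-- Moving the argument of a polynomial by a multiple of `l` changes it by a multiple of `l`. -/
lemma exists_eval_add_smul_eq (l : MvPolynomial σ K) (hl : l.totalDegree ≤ 1) (e : σ → K)
    {d : ℕ} (g : MvPolynomial σ K) (hg : g.totalDegree ≤ d + 1) :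
    ∃ q : MvPolynomial σ K, q.totalDegree ≤ d ∧ ∀ x : σ → K,
      eval (x + eval x l • e) g = eval x g + eval x l * eval x q := by
  have hmon : ∀ m : g.support, ∃ q : MvPolynomial σ K, q.totalDegree ≤ d ∧ ∀ x : σ → K,
      eval (x + eval x l • e) (monomial m.1 1) =
        eval x (monomial m.1 1) + eval x l * eval x q := by
    rintro ⟨m, hm⟩
    obtain ⟨q, hq, h⟩ := exists_eval_multiset_prod_add_smul l hl e (Finsupp.toMultiset m) d
      ((by rw [Finsupp.card_toMultiset]; exact le_totalDegree hm : _ ≤ g.totalDegree).trans hg)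
    refine ⟨q, hq, fun x => ?_⟩
    have hX : monomial m (1 : K) = ((Finsupp.toMultiset m).map X).prod := by
      rw [monomial_eq, C_1, one_mul, Finsupp.toMultiset_map, Finsupp.prod_toMultiset,
        Finsupp.prod_mapDomain_index (by simp) (by intros; rw [pow_add])]
    rw [hX]
    exact h x
  choose q hq h using hmon
  refine ⟨∑ m : g.support, C (g.coeff m.1) * q m, ?_, fun x => ?_⟩
  · refine totalDegree_finsetSum_le fun m _ => (totalDegree_mul _ _).trans ?_
    rw [totalDegree_C, zero_add]
    exact hq m
  · have hsum : ∀ y : σ → K, eval y g =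
        ∑ m : g.support, g.coeff m.1 * eval y (monomial m.1 1) := by
      intro y
      conv_lhs => rw [g.as_sum]
      rw [map_sum, ← Finset.sum_coe_sort g.support]
      refine Finset.sum_congr rfl fun m _ => ?_
      rw [← eval_C (f := y) (g.coeff m.1), ← map_mul, C_mul_monomial, mul_one, eval_C]
    rw [hsum, hsum x, map_sum, Finset.mul_sum, ← Finset.sum_add_distrib]
    refine Finset.sum_congr rfl fun m _ => ?_
    rw [h m x, map_mul, eval_C]
    ring

lemma exists_eval_eq_fwdDiff {d : ℕ} (g : MvPolynomial σ K) (hg : g.totalDegree ≤ d + 1)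
    (a : σ → K) : ∃ q : MvPolynomial σ K, q.totalDegree ≤ d ∧
      fwdDiff a (fun x => eval x g) = fun x => eval x q := by
  obtain ⟨q, hq, h⟩ := exists_eval_add_smul_eq 1 (by simp) a g hg
  refine ⟨q, hq, funext fun x => ?_⟩
  have := h x
  simp only [map_one, one_smul, one_mul] at this
  rw [fwdDiff, this, add_sub_cancel_left]

lemma fwdDiff_fourth_eq_zero_of_totalDegree_le {g : MvPolynomial σ K} (hg : g.totalDegree ≤ 3)
    (a b c d x : σ → K) :
    fwdDiff d (fwdDiff c (fwdDiff b (fwdDiff a fun x => eval x g))) x = 0 := by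
  obtain ⟨g₁, h₁, e₁⟩ := exists_eval_eq_fwdDiff g hg a
  obtain ⟨g₂, h₂, e₂⟩ := exists_eval_eq_fwdDiff g₁ h₁ b
  obtain ⟨g₃, h₃, e₃⟩ := exists_eval_eq_fwdDiff g₂ h₂ c
  rw [e₁, e₂, e₃, totalDegree_eq_zero_iff_eq_C.1 (Nat.le_zero.1 h₃)]
  simp [fwdDiff]

variable {p n : ℕ} [Fact p.Prime]

lemma exists_isHomogeneous_one_eval_eq (L : (Fin n → ZMod p) →ₗ[ZMod p] ZMod p) :
    ∃ l : MvPolynomial (Fin n) (ZMod p), l.IsHomogeneous 1 ∧ ∀ x, eval x l = L x := by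
  refine ⟨∑ i, C (L (Pi.single i 1)) * X i, ?_, fun x => ?_⟩
  · refine IsHomogeneous.sum _ _ _ fun i _ => ?_
    simpa using (isHomogeneous_C (Fin n) (L (Pi.single i 1))).mul (isHomogeneous_X (ZMod p) i)
  · rw [LinearMap.pi_apply_eq_sum_univ L x, map_sum]
    refine Finset.sum_congr rfl fun i _ => ?_
    rw [map_mul, eval_C, eval_X, smul_eq_mul, mul_comm]
    congr 3
    ext j
    simp [Pi.single_apply, eq_comm]

lemma exists_eval_eq_bilinForm_self (M : LinearMap.BilinForm (ZMod p) (Fin n → ZMod p)) :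
    ∃ g : MvPolynomial (Fin n) (ZMod p), g.totalDegree ≤ 2 ∧ ∀ x, eval x g = M x x := by
  choose l hl h using fun i : Fin n => exists_isHomogeneous_one_eval_eq
    (M (Pi.single i 1))
  refine ⟨∑ i, X i * l i, ?_, fun x => ?_⟩
  · refine totalDegree_finsetSum_le fun i _ => (totalDegree_mul _ _).trans ?_
    have := (hl i).totalDegree_le
    rw [totalDegree_X]
    omega
  · rw [map_sum]
    have := LinearMap.pi_apply_eq_sum_univ M x
    conv_rhs => rw [this]
    rw [LinearMap.sum_apply]
    refine Finset.sum_congr rfl fun i _ => ?_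
    rw [map_mul, eval_X, h, LinearMap.smul_apply, smul_eq_mul]
    congr 4
    ext j
    simp [Pi.single_apply, eq_comm]

/-- In every characteristic, the polarization of a function with vanishing third differences
splits as `M + Mᵀ`. -/
lemma exists_add_flip_eq {f : (Fin n → ZMod p) → ZMod p}
    (B : LinearMap.BilinForm (ZMod p) (Fin n → ZMod p))
    (hB : ∀ a b x, B a b = fwdDiff b (fwdDiff a f) x) :
    ∃ M : LinearMap.BilinForm (ZMod p) (Fin n → ZMod p), ∀ a b, M a b + M b a = B a b := by
  have hsymm : ∀ a b, B a b = B b a := fun a b => by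
    rw [hB a b 0, hB b a 0, fwdDiff_comm]
  -- In characteristic two `B a a = f (2a) - 2 f a + f 0` vanishes, so halving the diagonal is
  -- harmless.
  have hdiag : ∀ a, B a a * 2⁻¹ + B a a * 2⁻¹ = B a a := by
    intro a
    by_cases h2 : (2 : ZMod p) = 0
    · have ha : a + a = 0 := by
        ext i
        rw [Pi.add_apply, ← two_mul, h2, zero_mul]
        rfl
      have : B a a = 0 := by
        rw [hB a a 0]
        simp only [fwdDiff, zero_add, ha]
        linear_combination (f 0 - f a) * h2
      simp [this]
    · field_simp
      ring
  let m : Matrix (Fin n) (Fin n) (ZMod p) := Matrix.of fun i j =>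
    if i < j then B (Pi.single i 1) (Pi.single j 1)
    else if i = j then B (Pi.single i 1) (Pi.single i 1) * 2⁻¹ else 0
  have hm : m + m.transpose = LinearMap.BilinForm.toMatrix' B := by
    ext i j
    simp only [m, Matrix.add_apply, Matrix.transpose_apply, Matrix.of_apply,
      LinearMap.BilinForm.toMatrix'_apply]
    rcases lt_trichotomy i j with h | h | h
    · simp [h, h.not_gt, h.ne']
    · subst h
      simpa using hdiag _
    · simp [h, h.not_gt, h.ne', hsymm (Pi.single i 1)]
  refine ⟨Matrix.toBilin' m, fun a b => ?_⟩
  rw [← Matrix.toBilin'_toMatrix' B, ← hm, map_add, LinearMap.add_apply, LinearMap.add_apply]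
  congr 1
  rw [Matrix.toBilin'_apply, Matrix.toBilin'_apply, Finset.sum_comm]
  refine Finset.sum_congr rfl fun i _ => Finset.sum_congr rfl fun j _ => ?_
  rw [Matrix.transpose_apply]
  ring

/-- A function with vanishing third differences is a quadratic polynomial. -/
theorem exists_totalDegree_le_two_of_fwdDiff_eq_zero {f : (Fin n → ZMod p) → ZMod p}
    (hf : ∀ a b c x, fwdDiff c (fwdDiff b (fwdDiff a f)) x = 0) :
    ∃ g : MvPolynomial (Fin n) (ZMod p), g.totalDegree ≤ 2 ∧ ∀ x, eval x g = f x := by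
  obtain ⟨B, hB⟩ := exists_bilinForm_of_fwdDiff_eq_zero hf
  obtain ⟨M, hM⟩ := exists_add_flip_eq B hB
  obtain ⟨Q, hQ, hQe⟩ := exists_eval_eq_bilinForm_self M
  -- The second difference of `x ↦ M x x` is `M + Mᵀ = B`, so subtracting it leaves an affine
  -- function.
  obtain ⟨L, hL⟩ := exists_linearMap_of_fwdDiff_fwdDiff_eq_zero
    (f := fun x => f x - M x x) (by
      intro a b x
      have h₁ := hB a b x
      have h₂ := hM a b
      simp only [fwdDiff, map_add, LinearMap.add_apply] at h₁ ⊢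
      linear_combination -h₂ - h₁)
  obtain ⟨l, hl, hle⟩ := exists_isHomogeneous_one_eval_eq L
  refine ⟨Q + l + C (f 0), ?_, fun x => ?_⟩
  · have h₁ := totalDegree_add (Q + l) (C (f 0))
    have h₂ := totalDegree_add Q l
    have h₃ := hl.totalDegree_le
    rw [totalDegree_C] at h₁
    omega
  · have := hL x 0
    simp only [fwdDiff, zero_add, map_zero, sub_zero] at this
    rw [map_add, map_add, hQe, hle, eval_C, this]
    ring

/-- A cubic polynomial whose third differences vanish on a subspace of codimension `c` is a
quadratic polynomial plus `c` products of a linear form with a quadratic polynomial. -/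
theorem exists_eval_eq_sum_mul_add_of_fwdDiff_eq_zero (c : ℕ) :
    ∀ (g : MvPolynomial (Fin n) (ZMod p)), g.totalDegree ≤ 3 →
      ∀ U : Submodule (ZMod p) (Fin n → ZMod p),
      Module.finrank (ZMod p) ((Fin n → ZMod p) ⧸ U) ≤ c →
      (∀ u ∈ U, ∀ v ∈ U, ∀ w ∈ U, ∀ x,
        fwdDiff w (fwdDiff v (fwdDiff u fun x => eval x g)) x = 0) →
      ∃ (q₀ : MvPolynomial (Fin n) (ZMod p)) (q l : Fin c → MvPolynomial (Fin n) (ZMod p)),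
        q₀.totalDegree ≤ 2 ∧ (∀ j, (q j).totalDegree ≤ 2) ∧ (∀ j, (l j).IsHomogeneous 1) ∧
        ∀ x, eval x g = (∑ j, eval x (l j) * eval x (q j)) + eval x q₀ := by
  induction c with
  | zero =>
    intro g hg U hU hvan
    have hquot := Submodule.finrank_quotient_add_finrank U
    have htop : U = ⊤ := Submodule.eq_top_of_finrank_eq (by omega)
    subst htop
    obtain ⟨q₀, hq₀, h⟩ := exists_totalDegree_le_two_of_fwdDiff_eq_zero
      (fun a b c x => hvan a trivial b trivial c trivial x)
    exact ⟨q₀, 0, 0, hq₀, fun j => j.elim0, fun j => j.elim0, fun x => by simp [h]⟩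
  | succ c ih =>
    intro g hg U hU hvan
    rcases eq_or_ne U ⊤ with rfl | hne
    · obtain ⟨q₀, hq₀, h⟩ := exists_totalDegree_le_two_of_fwdDiff_eq_zero
        (fun a b c x => hvan a trivial b trivial c trivial x)
      exact ⟨q₀, 0, 0, hq₀, fun j => by simp, fun j => isHomogeneous_zero _ _ _,
        fun x => by simp [h]⟩
    · obtain ⟨L, hL0, hLU⟩ := Submodule.exists_le_ker_of_lt_top U (lt_top_iff_ne_top.2 hne)
      obtain ⟨e, he⟩ : ∃ e, L e = 1 := by
        obtain ⟨y, hy⟩ := DFunLike.exists_ne hL0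
        exact ⟨(L y)⁻¹ • y, by simpa using inv_mul_cancel₀ hy⟩
      obtain ⟨l, hl, hle⟩ := exists_isHomogeneous_one_eval_eq (-L)
      obtain ⟨q, hq, hqe⟩ := exists_eval_add_smul_eq l hl.totalDegree_le e g hg
      -- `τ x = x - L x • e` projects onto `ker L` along `e` and sends `U + ⟨e⟩` into `U`. So the
      -- third differences of `g ∘ τ = g + l q` vanish on a space one dimension larger.
      let τ : (Fin n → ZMod p) →ₗ[ZMod p] (Fin n → ZMod p) :=
        LinearMap.id + (-L).smulRight e
      have hτ : (fun x => eval x (g + l * q)) = (fun x => eval x g) ∘ τ := by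
        ext x
        rw [map_add, map_mul, ← hqe, hle]
        rfl
      have hτU : ∀ u ∈ U ⊔ Submodule.span (ZMod p) {e}, τ u ∈ U := by
        intro u hu
        obtain ⟨v, hv, w, hw, rfl⟩ := Submodule.mem_sup.1 hu
        obtain ⟨t, rfl⟩ := Submodule.mem_span_singleton.1 hw
        have hLv : L v = 0 := hLU hv
        have : τ (v + t • e) = v := by
          simp [τ, hLv, he]
        rwa [this]
      have hlt : U < U ⊔ Submodule.span (ZMod p) {e} := by
        refine lt_of_le_of_ne le_sup_left fun h => ?_
        have heU : e ∈ U := by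
          rw [h]
          exact Submodule.mem_sup_right (Submodule.mem_span_singleton_self e)
        have : L e = 0 := hLU heU
        rw [he] at this
        exact one_ne_zero this
      have hfin := Submodule.finrank_lt_finrank_of_lt hlt
      have hd₁ := Submodule.finrank_quotient_add_finrank U
      have hd₂ := Submodule.finrank_quotient_add_finrank (U ⊔ Submodule.span (ZMod p) {e})
      obtain ⟨q₀, q', l', hq₀, hq', hl', h⟩ := ih (g + l * q)
        (by
          have h₁ := totalDegree_add g (l * q)
          have h₂ := totalDegree_mul l q
          have h₃ := hl.totalDegree_le
          omega)
        (U ⊔ Submodule.span (ZMod p) {e}) (by omega)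
        (by
          intro u hu v hv w hw x
          rw [hτ, fwdDiff_comp_linearMap, fwdDiff_comp_linearMap, fwdDiff_comp_linearMap]
          exact hvan _ (hτU u hu) _ (hτU v hv) _ (hτU w hw) _)
      refine ⟨q₀, Fin.cons (-q) q', Fin.cons l l', hq₀, ?_, ?_, fun x => ?_⟩
      · exact Fin.cases (by simpa using hq) hq'
      · exact Fin.cases hl hl'
      · have := h x
        rw [map_add, map_mul] at this
        rw [Fin.sum_univ_succ]
        simp only [Fin.cons_zero, Fin.cons_succ, map_neg]
        linear_combination this

end Polynomials

/-! ### Biased trilinear forms -/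

section Trilinear

open Module

variable {p : ℕ} [Fact p.Prime] {V : Type*} [AddCommGroup V] [Module (ZMod p) V]

lemma natCard_eq_pow_finrank_range_mul [Finite V] {V' : Type*} [AddCommGroup V'] [Module (ZMod p) V']
    (B : V →ₗ[ZMod p] V') :
    Nat.card V = p ^ finrank (ZMod p) (LinearMap.range B) * Nat.card (LinearMap.ker B) := by
  have := Fintype.ofFinite V
  have := Fintype.ofFinite (LinearMap.ker B)
  rw [Nat.card_eq_fintype_card, Nat.card_eq_fintype_card,
    Module.card_eq_pow_finrank (K := ZMod p) (V := V),
    Module.card_eq_pow_finrank (K := ZMod p) (V := LinearMap.ker B), ZMod.card, ← pow_add,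
    LinearMap.finrank_range_add_finrank_ker]

/-- A trilinear form of large bias, symmetric in its last two arguments, vanishes on a subspace of
small codimension. -/
theorem exists_isotropic_of_sum_card_ker [Fintype V]
    (T : V →ₗ[ZMod p] LinearMap.BilinForm (ZMod p) V) (hT : ∀ y, (T y).IsSymm) {β : ℝ}
    (hβ : 0 < β)
    (hsum : ∑ y, (Nat.card (LinearMap.ker (T y)) : ℝ) = β * (Nat.card V : ℝ) ^ 2) :
    ∃ U : Submodule (ZMod p) V, (∀ u ∈ U, ∀ v ∈ U, ∀ w ∈ U, T u v w = 0) ∧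
      (finrank (ZMod p) (V ⧸ U) : ℝ) ≤ 32 * Real.log (2 / β) ^ 2 + 15 * Real.log (2 / β) := by
  classical
  set N : ℝ := (Nat.card V : ℝ) with hN
  set L := Real.log (2 / β) with hL
  have hN0 : 0 < N := by rw [hN]; exact_mod_cast Nat.card_pos
  have hkerN : ∀ y, (Nat.card (LinearMap.ker (T y)) : ℝ) ≤ N := fun y => by
    rw [hN]
    exact_mod_cast Nat.card_le_card_of_injective _ Subtype.val_injective
  have hcardN : (Fintype.card V : ℝ) = N := by rw [hN, Nat.card_eq_fintype_card]
  have hβ1 : β ≤ 1 := by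
    have h := Finset.sum_le_sum fun y (_ : y ∈ Finset.univ) => hkerN y
    rw [hsum, Finset.sum_const, Finset.card_univ, nsmul_eq_mul, hcardN, ← sq] at h
    exact le_of_mul_le_mul_right (by linarith) (pow_pos hN0 2)
  have hL0 : 0 ≤ L := Real.log_nonneg (by rw [le_div_iff₀ hβ]; linarith)
  let A : Finset V := {y | β / 2 * N ≤ (Nat.card (LinearMap.ker (T y)) : ℝ)}
  have hmemA : ∀ y, y ∈ A ↔ β / 2 * N ≤ (Nat.card (LinearMap.ker (T y)) : ℝ) := by simp [A]
  have hA0 : (0 : V) ∈ A := by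
    rw [hmemA, map_zero, LinearMap.ker_zero, Nat.card_congr Submodule.topEquiv.toEquiv, ← hN]
    nlinarith
  have hAsmul : ∀ c : ZMod p, c ≠ 0 → ∀ a ∈ A, c • a ∈ A := by
    intro c hc a ha
    rw [hmemA] at ha ⊢
    rwa [map_smul, LinearMap.ker_smul _ _ hc]
  have hAcard : β / 2 * N ≤ A.card := by
    have h : ∑ y, (Nat.card (LinearMap.ker (T y)) : ℝ) ≤
        ∑ y : V, ((if y ∈ A then N else 0) + β / 2 * N) := by
      refine Finset.sum_le_sum fun y _ => ?_
      split_ifs with hy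
      · have := hkerN y
        have : 0 ≤ β / 2 * N := by positivity
        linarith
      · rw [hmemA, not_le] at hy
        linarith
    rw [hsum, Finset.sum_add_distrib, ← Finset.sum_filter, Finset.sum_const, Finset.sum_const,
      Finset.card_univ, nsmul_eq_mul, nsmul_eq_mul, hcardN, Finset.filter_mem_eq_inter,
      Finset.univ_inter] at h
    nlinarith
  -- The bound `1 - 1/x ≤ log x` gives `c = 1/2, 1/3, 1/8` for `x = 2, 3/2, 8/7`: rank, codimension
  -- of `H` and number of summands.
  have hlog : ∀ {x : ℝ} {m : ℕ} {c : ℝ}, 0 < x → c ≤ 1 - x⁻¹ → x ^ m ≤ 2 / β → m * c ≤ L := by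
    intro x m c hx hc h
    have h₁ := Real.log_le_log (by positivity) h
    rw [Real.log_pow] at h₁
    exact (mul_le_mul_of_nonneg_left (hc.trans (Real.one_sub_inv_le_log_of_pos hx))
      (Nat.cast_nonneg m)).trans h₁
  have hrankA : ∀ y ∈ A, finrank (ZMod p) (LinearMap.range (T y)) ≤ ⌊2 * L⌋₊ := by
    intro y hy
    rw [hmemA] at hy
    refine Nat.le_floor ?_
    have h := natCard_eq_pow_finrank_range_mul (T y)
    have h' : N = (p : ℝ) ^ finrank (ZMod p) (LinearMap.range (T y)) *
        Nat.card (LinearMap.ker (T y)) := by rw [hN]; exact_mod_cast h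
    have hp : (2 : ℝ) ≤ p := by exact_mod_cast (Fact.out : p.Prime).two_le
    have h2 : (2 : ℝ) ^ finrank (ZMod p) (LinearMap.range (T y)) ≤ 2 / β := by
      rw [le_div_iff₀ hβ]
      refine le_of_mul_le_mul_right ?_ hN0
      calc (2 : ℝ) ^ finrank (ZMod p) (LinearMap.range (T y)) * β * N
          ≤ (p : ℝ) ^ finrank (ZMod p) (LinearMap.range (T y)) * (β * N) := by
            rw [mul_assoc]; gcongr
        _ ≤ (p : ℝ) ^ finrank (ZMod p) (LinearMap.range (T y)) *
            (2 * Nat.card (LinearMap.ker (T y))) := by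
            exact mul_le_mul_of_nonneg_left (by linarith) (by positivity)
        _ = 2 * N := by rw [h']; ring
    have := hlog (c := 1 / 2) two_pos (by norm_num) h2
    linarith
  obtain ⟨H, hHcodim, hHcover⟩ := exists_submodule_forall_mem_eq_add_sum (p := p) A hA0 hAsmul
  have hHc : (finrank (ZMod p) (V ⧸ H) : ℝ) ≤ 3 * L := by
    have : (3 / 2 : ℝ) ^ finrank (ZMod p) (V ⧸ H) ≤ 2 / β := by
      rw [le_div_iff₀ hβ]
      have h := (mul_le_mul_of_nonneg_left hAcard
        (by positivity : (0 : ℝ) ≤ (3 / 2) ^ finrank (ZMod p) (V ⧸ H))).trans hHcodim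
      rw [← hN] at h
      refine le_of_mul_le_mul_right ?_ hN0
      linarith
    have := hlog (c := 1 / 3) (by norm_num) (by norm_num) this
    linarith
  set k := ⌊8 * L⌋₊ + 1 with hk
  have hkL : (k : ℝ) ≤ 8 * L + 1 := by
    rw [hk]
    push_cast
    linarith [Nat.floor_le (by positivity : 0 ≤ 8 * L)]
  have hkpow : (7 / 8 : ℝ) ^ k * Nat.card V < A.card := by
    refine lt_of_lt_of_le ?_ hAcard
    rw [← hN]
    refine mul_lt_mul_of_pos_right ?_ hN0
    by_contra! hle
    have : (8 / 7 : ℝ) ^ k ≤ 2 / β := by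
      rw [le_div_iff₀ hβ]
      have h := mul_le_mul_of_nonneg_left hle (by positivity : (0 : ℝ) ≤ (8 / 7) ^ k)
      rw [← mul_pow] at h
      norm_num at h
      linarith
    have h := hlog (c := 1 / 8) (by norm_num) (by norm_num) this
    have := Nat.lt_floor_add_one (8 * L)
    rw [hk] at h
    push_cast at h
    linarith
  have hrankH : ∀ h ∈ H, finrank (ZMod p) (LinearMap.range (T h)) ≤ (k + 2) * ⌊2 * L⌋₊ := by
    intro h hh
    obtain ⟨a, ha, b, hb, t, ht, rfl⟩ := hHcover k hkpow h hh
    have hs : ∀ s : Finset (Fin k), finrank (ZMod p) (LinearMap.range (T (∑ j ∈ s, t j))) ≤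
        s.card * ⌊2 * L⌋₊ := by
      intro s
      induction s using Finset.induction_on with
      | empty =>
        rw [Finset.sum_empty, map_zero, LinearMap.range_zero, finrank_bot]
        exact Nat.zero_le _
      | insert i s hi ih =>
        rw [Finset.sum_insert hi, Finset.card_insert_of_notMem hi, map_add]
        have h₁ := finrank_range_add_le_of_finiteDimensional (T (t i)) (T (∑ j ∈ s, t j))
        have h₂ := hrankA _ (ht i)
        linarith
    have h₀ := hs Finset.univ
    rw [Finset.card_univ, Fintype.card_fin] at h₀
    have h₁ := finrank_range_add_le_of_finiteDimensional (T a + T b) (T (∑ j, t j))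
    have h₂ := finrank_range_add_le_of_finiteDimensional (T a) (T b)
    have h₃ := hrankA a ha
    have h₄ := hrankA b hb
    rw [map_add, map_add]
    linarith
  obtain ⟨W, hWdim, hW⟩ := exists_isotropic_of_finrank_range_le ((k + 2) * ⌊2 * L⌋₊)
    (H.map T) (by rintro _ ⟨h, _, rfl⟩; exact hT h)
    (by rintro _ ⟨h, hh, rfl⟩; exact hrankH h hh)
  refine ⟨H ⊓ W, fun u hu v hv w hw => hW _ ⟨u, hu.1, rfl⟩ v hv.2 w hw.2, ?_⟩
  have d₁ := Submodule.finrank_quotient_add_finrank H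
  have d₂ := Submodule.finrank_quotient_add_finrank (H ⊓ W)
  have d₃ := Submodule.finrank_sup_add_finrank_inf_eq H W
  have d₄ := Submodule.finrank_le (H ⊔ W)
  have hcodim : finrank (ZMod p) (V ⧸ (H ⊓ W)) ≤
      finrank (ZMod p) (V ⧸ H) + 2 * ((k + 2) * ⌊2 * L⌋₊) := by omega
  have hcodim' : (finrank (ZMod p) (V ⧸ (H ⊓ W)) : ℝ) ≤
      finrank (ZMod p) (V ⧸ H) + 2 * ((k + 2) * ⌊2 * L⌋₊) := by exact_mod_cast hcodim
  have hfl : (⌊2 * L⌋₊ : ℝ) ≤ 2 * L := Nat.floor_le (by positivity)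
  -- The total is `3L + 2 (8L + 3)(2L) = 32L² + 15L`.
  have hmul : ((k : ℝ) + 2) * ⌊2 * L⌋₊ ≤ (8 * L + 3) * (2 * L) :=
    mul_le_mul (by linarith) hfl (Nat.cast_nonneg _) (by linarith)
  nlinarith

lemma natCard_ker_le_half [Finite V] {V' : Type*} [AddCommGroup V'] [Module (ZMod p) V']
    (B : V →ₗ[ZMod p] V') (hB : B ≠ 0) :
    (Nat.card (LinearMap.ker B) : ℝ) ≤ Nat.card V / 2 := by
  have h := natCard_eq_pow_finrank_range_mul B
  have hp : (2 : ℝ) ≤ p := by exact_mod_cast (Fact.out : p.Prime).two_le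
  have hr : finrank (ZMod p) (LinearMap.range B) ≠ 0 := by
    rw [Ne, Submodule.finrank_eq_zero, LinearMap.range_eq_bot]
    exact hB
  have hpow : (2 : ℝ) ≤ (p : ℝ) ^ finrank (ZMod p) (LinearMap.range B) :=
    hp.trans (le_self_pow₀ (by linarith) hr)
  have h' : (Nat.card V : ℝ) = (p : ℝ) ^ finrank (ZMod p) (LinearMap.range B) *
      Nat.card (LinearMap.ker B) := by exact_mod_cast h
  rw [h']
  have := mul_le_mul_of_nonneg_right hpow
    (Nat.cast_nonneg (α := ℝ) (Nat.card (LinearMap.ker B)))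
  linarith

/-- The bias of a nonzero trilinear form is at most `3 / 4`. -/
lemma sum_card_ker_le [Fintype V] (T : V →ₗ[ZMod p] LinearMap.BilinForm (ZMod p) V)
    (hT : T ≠ 0) :
    ∑ y, (Nat.card (LinearMap.ker (T y)) : ℝ) ≤ 3 / 4 * (Nat.card V : ℝ) ^ 2 := by
  classical
  have hker := natCard_ker_le_half (V' := LinearMap.BilinForm (ZMod p) V) T hT
  -- Nonzero `T y` has kernel of density at most `1/2`, and `T y = 0` for at most half of all `y`:
  -- `1/2 + 1/2 · 1/2 = 3/4`.
  have hle : ∑ y, (Nat.card (LinearMap.ker (T y)) : ℝ) ≤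
      ∑ y : V, ((if y ∈ LinearMap.ker T then (Nat.card V : ℝ) / 2 else 0) + Nat.card V / 2) := by
    refine Finset.sum_le_sum fun y _ => ?_
    split_ifs with hy
    · have : (Nat.card (LinearMap.ker (T y)) : ℝ) ≤ Nat.card V := by
        exact_mod_cast Nat.card_le_card_of_injective _ Subtype.val_injective
      linarith
    · have := natCard_ker_le_half (T y) hy
      linarith
  have hcard : ((Finset.univ.filter fun y => y ∈ LinearMap.ker T).card : ℝ) =
      Nat.card (LinearMap.ker T) := by
    rw [Nat.card_eq_fintype_card, Fintype.card_subtype]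
  refine hle.trans ?_
  rw [Finset.sum_add_distrib, ← Finset.sum_filter, Finset.sum_const, Finset.sum_const,
    Finset.card_univ, nsmul_eq_mul, nsmul_eq_mul, hcard, ← Nat.card_eq_fintype_card]
  have := mul_le_mul_of_nonneg_right hker (by positivity : (0 : ℝ) ≤ Nat.card V / 2)
  nlinarith

/-- The bias of a trilinear form as an average of kernel densities. -/
lemma sum_stdAddChar_trilinear [Fintype V] (T : V →ₗ[ZMod p] LinearMap.BilinForm (ZMod p) V) :
    ∑ a, ∑ b, ∑ c, (ZMod.stdAddChar (T a b c) : ℂ) =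
      ((Nat.card V : ℝ) * ∑ a, (Nat.card (LinearMap.ker (T a)) : ℝ) : ℝ) := by
  classical
  have hinner : ∀ L : V →ₗ[ZMod p] ZMod p,
      ∑ c, (ZMod.stdAddChar (L c) : ℂ) = if L = 0 then (Nat.card V : ℂ) else 0 := by
    intro L
    have h := AddChar.sum_eq_ite (ZMod.stdAddChar.compAddMonoidHom L.toAddMonoidHom)
    have hiff : ZMod.stdAddChar.compAddMonoidHom L.toAddMonoidHom = 0 ↔ L = 0 := by
      rw [AddChar.eq_zero_iff]
      constructor
      · intro h
        ext x
        refine ZMod.injective_stdAddChar ?_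
        simpa using h x
      · rintro rfl x
        simp
    rw [← Nat.card_eq_fintype_card] at h
    simp only [hiff] at h
    exact h
  -- The sum over `c` is `|V|` when `T a b = 0` and zero otherwise; it remains to count `b ∈ ker (T
  -- a)`.
  simp_rw [hinner]
  push_cast
  rw [Finset.mul_sum]
  refine Finset.sum_congr rfl fun a _ => ?_
  rw [← Finset.sum_filter, Finset.sum_const, nsmul_eq_mul, mul_comm, Nat.card_eq_fintype_card,
    Nat.card_eq_fintype_card, Fintype.card_subtype]
  simp only [LinearMap.mem_ker]

end Trilinear

/-! ### The `U³` norm as the bias of the trilinear form -/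

section GowersNorm

variable {p n : ℕ} [Fact p.Prime]

lemma sum_fin_three_pi {V M : Type*} [Fintype V] [AddCommMonoid M] (F : V → V → V → M) :
    ∑ y : Fin 3 → V, F (y 0) (y 1) (y 2) = ∑ a, ∑ b, ∑ c, F a b c := by
  let e : (Fin 3 → V) ≃ V × V × V :=
    { toFun := fun y => (y 0, y 1, y 2)
      invFun := fun t => ![t.1, t.2.1, t.2.2]
      left_inv := fun y => by ext i; fin_cases i <;> rfl
      right_inv := fun _ => rfl }
  have h : ∑ y : Fin 3 → V, F (y 0) (y 1) (y 2) = ∑ t : V × V × V, F t.1 t.2.1 t.2.2 :=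
    Fintype.sum_equiv e _ _ fun _ => rfl
  rw [h]
  simp_rw [Fintype.sum_prod_type]

/-- The average over `x` is trivial because the third difference is constant, and the bias is a
nonnegative real, so taking its norm changes nothing. -/
lemma gowersNorm_three_eq {f : (Fin n → ZMod p) → ZMod p}
    (T : (Fin n → ZMod p) →ₗ[ZMod p] LinearMap.BilinForm (ZMod p) (Fin n → ZMod p))
    (hT : ∀ a b c x, T a b c = fwdDiff c (fwdDiff b (fwdDiff a f)) x) :
    gowersNorm 3 f = ((∑ a, (Nat.card (LinearMap.ker (T a)) : ℝ)) /
      (Nat.card (Fin n → ZMod p) : ℝ) ^ 2) ^ ((1 : ℝ) / 8) := by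
  have hiter : ∀ (x : Fin n → ZMod p) (y : Fin 3 → Fin n → ZMod p),
      iterDeriv 3 y f x = T (y 0) (y 1) (y 2) := fun x y => (hT _ _ _ x).symm
  have hN : (Nat.card (Fin n → ZMod p) : ℝ) ≠ 0 := by exact_mod_cast Nat.card_pos.ne'
  have hbias : (𝔼 x : Fin n → ZMod p, 𝔼 y : Fin 3 → (Fin n → ZMod p),
      (ZMod.stdAddChar (iterDeriv 3 y f x) : ℂ)) =
      (((∑ a, (Nat.card (LinearMap.ker (T a)) : ℝ)) /
        (Nat.card (Fin n → ZMod p) : ℝ) ^ 2 : ℝ) : ℂ) := by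
    simp_rw [hiter]
    rw [Fintype.expect_const, Fintype.expect_eq_sum_div_card,
      sum_fin_three_pi (fun a b c => (ZMod.stdAddChar (T a b c) : ℂ)), sum_stdAddChar_trilinear,
      Fintype.card_fun, Fintype.card_fin, ← Nat.card_eq_fintype_card]
    rw [← Complex.ofReal_natCast, ← Complex.ofReal_div]
    congr 1
    push_cast
    field_simp
  rw [gowersNorm, hbias, Complex.norm_real, Real.norm_of_nonneg (by positivity)]
  norm_num

end GowersNorm

/-! ### Conclusion -/

theorem mainTheorem2 :
    ∃ C : ℝ, 0 < C ∧
      ∀ (p : ℕ) [Fact p.Prime] (n : ℕ) (f : MvPolynomial (Fin n) (ZMod p)) (δ : ℝ),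
        IsCubicPoly f →
        gowersNorm 3 (fun x : Fin n → ZMod p => MvPolynomial.eval x f) = δ →
        ∃ (c : ℕ) (q : Fin (c + 1) → MvPolynomial (Fin n) (ZMod p))
          (l : Fin c → MvPolynomial (Fin n) (ZMod p)),
          ((c + 1 : ℕ) : ℝ) ≤ C * Real.log (1 / δ) ^ 2 ∧
          (∀ j, (q j).totalDegree ≤ 2) ∧
          (∀ j, (l j).IsHomogeneous 1) ∧
          ∀ x : Fin n → ZMod p,
            MvPolynomial.eval x f =
              (∑ j : Fin c, MvPolynomial.eval x (l j) * MvPolynomial.eval x (q j.succ)) +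
                MvPolynomial.eval x (q 0) := by
  refine ⟨100000, by norm_num, ?_⟩
  rintro p _ n f δ ⟨⟨g, hg, hgf⟩, hf2⟩ hδ
  have hfg : (fun x : Fin n → ZMod p => MvPolynomial.eval x f) =
      fun x => MvPolynomial.eval x g := funext fun x => (hgf x).symm
  obtain ⟨T, hT⟩ := exists_trilinear_of_fwdDiff_eq_zero
    (f := fun x : Fin n → ZMod p => MvPolynomial.eval x g)
    (fwdDiff_fourth_eq_zero_of_totalDegree_le hg)
  have hT0 : T ≠ 0 := by
    rintro rfl
    obtain ⟨q, hq, h⟩ := exists_totalDegree_le_two_of_fwdDiff_eq_zero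
      (fun a b c x => (hT a b c x).symm)
    exact hf2 ⟨q, hq, fun x => (h x).trans (hgf x)⟩
  have hsymm : ∀ y, (T y).IsSymm := fun y => ⟨fun a b => by
    rw [hT y a b 0, hT y b a 0, fwdDiff_comm]⟩
  have hN : (0 : ℝ) < (Nat.card (Fin n → ZMod p) : ℝ) ^ 2 :=
    pow_pos (by exact_mod_cast Nat.card_pos) 2
  set β : ℝ := (∑ a, (Nat.card (LinearMap.ker (T a)) : ℝ)) /
    (Nat.card (Fin n → ZMod p) : ℝ) ^ 2 with hβdef
  have hβ : 0 < β := div_pos (Finset.sum_pos (fun a _ => by exact_mod_cast Nat.card_pos)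
    Finset.univ_nonempty) hN
  have hβ1 : β ≤ 3 / 4 := (div_le_iff₀ hN).2 (sum_card_ker_le T hT0)
  rw [hfg, gowersNorm_three_eq T hT, ← hβdef] at hδ
  set m := Real.log (1 / δ) with hm
  have hmβ : Real.log (1 / β) = 8 * m := by
    rw [hm, ← hδ, one_div, one_div, Real.log_inv, Real.log_inv, Real.log_rpow hβ]
    ring
  have hL : Real.log (2 / β) = Real.log 2 + 8 * m := by
    rw [← hmβ, ← Real.log_mul two_ne_zero (by positivity), mul_one_div]
  -- From `8m = log (1/β) ≥ 1 - β ≥ 1/4`.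
  have hm32 : 1 / 32 ≤ m := by
    have h := Real.one_sub_inv_le_log_of_pos (one_div_pos.2 hβ)
    rw [hmβ, one_div, inv_inv] at h
    linarith
  have hlog2 : Real.log 2 ≤ 1 := by
    have := Real.log_le_sub_one_of_pos (two_pos (α := ℝ))
    linarith
  have hlog2' : 0 ≤ Real.log 2 := Real.log_nonneg one_le_two
  obtain ⟨U, hU, hUcodim⟩ := exists_isotropic_of_sum_card_ker T hsymm hβ
    (by rw [hβdef, div_mul_cancel₀ _ hN.ne'])
  obtain ⟨q₀, q, l, hq₀, hq, hl, h⟩ := exists_eval_eq_sum_mul_add_of_fwdDiff_eq_zero _ g hg U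
    le_rfl fun u hu v hv w hw x => by rw [← hT, hU u hu v hv w hw]
  refine ⟨_, Fin.cons q₀ q, l, ?_, Fin.cases hq₀ hq, hl, fun x => ?_⟩
  · rw [hL] at hUcodim
    push_cast
    -- Since `1 ≤ 32m`, the bound `32 (40m)² + 15 · 40m + 1` is at most `(51200 + 19200 + 1024) m²`,
    -- below `100000 m²`.
    have hL40 : Real.log 2 + 8 * m ≤ 40 * m := by linarith
    have hsq : (Real.log 2 + 8 * m) ^ 2 ≤ (40 * m) ^ 2 := by gcongr
    nlinarith
  · rw [← hgf, h]
    simp only [Fin.cons_zero, Fin.cons_succ]
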